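/- Let $K$ be a complete graph of order $n\geq 4$ with vertex set $V$, and let $c:E(K)\to\{\pm 1\}$ be an edge labeling of $K$. For a graph $H$ with vertex set $V$, let $m(H)$ be the number of edges of $H$, and let $m^+(H)$ be the number of edges $e$ of $H$ with $c(e)=+1$. Let the real number $d$ be such that $m^+(K)=d\binom{n}{2}$. Let $G$ be a spanning subgraph of $K$ (that is, a graph with vertex set $V$) of maximum degree at most $\Delta$, where $\Delta$ is a non-negative integer. For a permutation $\pi$ of $V$, let $G_\pi$ be the isomorphic copy of $G$ in $K$ with edge set $\{\pi(u)\pi(v):uv\in E(G)\}$. Then there is a permutation $\pi$ of $V$ with $$m^+(G_\pi)\geq \begin{cases} \left(d+\frac{2-d-2\sqrt{1-d}}{2\Delta+1}-\frac{3}{n-3}\right)m(G), & \text{if } d\binom{n}{2}\leq \frac{8n^2-14n+3}{25},\\[3mm] \left(d+\frac{\sqrt{d}-d}{2\Delta+1}-\frac{3}{n-3}\right)m(G), & \text{otherwise}. \end{cases}$$ -/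

import Mathlib

/-- `plusEdges c H` is `m⁺(H)`, the number of edges of the graph `H` on `V` that have label `+1`
under the labeling `c` of the edges of the complete graph on `V`. -/
noncomputable def plusEdges {V : Type*} (c : (⊤ : SimpleGraph V).edgeSet → ℤ)
    (H : SimpleGraph V) : ℕ :=
  {e : (⊤ : SimpleGraph V).edgeSet | (e : Sym2 V) ∈ H.edgeSet ∧ c e = 1}.ncard

/-- `permCopy G π` is `G_π`, the copy of `G` with edge set `{π(u)π(v) : uv ∈ E(G)}`. -/
def permCopy {V : Type*} (G : SimpleGraph V) (π : Equiv.Perm V) : SimpleGraph V :=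
  G.map π.toEmbedding

/-! A uniformly random copy of `G` has an expected fraction `d` of its edges labeled `+1`. To gain
on this, both `G` and the graph `P` of `+1` edges are given matchings of `V` that miss at most one
vertex and are rich in their own edges, and only permutations carrying one matching to the other are
averaged over.

These permutations form a coset of the centralizer of an involution `τ`. The centralizer is
transitive on the pairs matched by `τ`, on the pairs of matched vertices that are not partners, and
on the pairs with the unmatched vertex. Hence the expected overlap is, class by class, the product
of the two edge counts over the size of the class (`exists_perm_sum_ge`, `exists_copy_sum_ge`). If
the matching in `P` has density about `d + t`, each edge of `G` in its matching gains about `t`,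
while the remaining pairs of matched vertices keep density at least `d - O(1/n)`.

For `G`, bounded degree puts at least a fraction `1/(2Δ+1)` of the edges in the matching
(`exists_near_perfect_of_guest`). For `P`, the Erdős–Gallai bound (`sum_degree_le_of_matching_le`)
says that matching number `s` allows no more edges than a clique on `2s+1` vertices or `s` vertices
joined to everything. Inverting the relevant alternative gives `d + t = 2 - 2√(1-d)` or `d + t =
√d`; the two edge counts cross at the threshold of the theorem. The term `3/(n-3)` absorbs rounding,
the lower density off the matching, and the unmatched vertex. -/

/-- An involution all of whose transpositions are edges of `G` encodes a matching of `G`. -/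
def IsMatchingPerm {V : Type*} (G : SimpleGraph V) (τ : Equiv.Perm V) : Prop :=
  (∀ v, τ (τ v) = v) ∧ ∀ v, τ v ≠ v → G.Adj v (τ v)

/-! ### Maximum matchings, encoded as involutions. -/

namespace IsMatchingPerm

open Equiv

variable {V : Type*} [Fintype V] [DecidableEq V] {G : SimpleGraph V} {τ : Equiv.Perm V}

omit [Fintype V] [DecidableEq V] in
theorem one : IsMatchingPerm G (1 : Equiv.Perm V) := by
  simp [IsMatchingPerm]

theorem even_card_support (h : ∀ v, τ (τ v) = v) : Even τ.support.card := by
  rw [even_iff_two_dvd]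
  apply Equiv.Perm.two_dvd_card_support
  ext v
  simp [sq, h]

omit [Fintype V] in
theorem involutive_mul_swap (h : ∀ v, τ (τ v) = v) {u w : V} (hu : τ u = u) (hw : τ w = w) (v : V) :
    (τ * swap u w) ((τ * swap u w) v) = v := by
  have key : τ * swap u w = swap u w * τ := by
    rw [Equiv.mul_swap_eq_swap_mul, hu, hw]
  rw [← Perm.mul_apply]
  nth_rw 1 [key]
  rw [show swap u w * τ * (τ * swap u w) = swap u w * (τ * τ) * swap u w by group]
  have : τ * τ = 1 := by ext v; simp [h]
  simp [this]

theorem card_support_mul_swap {u w : V} (huw : u ≠ w) (hu : τ u = u) (hw : τ w = w) :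
    (τ * swap u w).support.card = τ.support.card + 2 := by
  rw [Perm.Disjoint.card_support_mul, Perm.card_support_swap huw]
  intro v
  by_cases h1 : v = u
  · simp [h1, hu]
  by_cases h2 : v = w
  · simp [h2, hw]
  right
  exact swap_apply_of_ne_of_ne h1 h2

omit [Fintype V] in
theorem mul_swap (h : IsMatchingPerm G τ) {u w : V} (hu : τ u = u) (hw : τ w = w)
    (ha : G.Adj u w) : IsMatchingPerm G (τ * swap u w) := by
  refine ⟨involutive_mul_swap h.1 hu hw, fun v hv => ?_⟩
  by_cases h1 : v = u
  · subst h1; simpa [hw] using ha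
  by_cases h2 : v = w
  · subst h2; simpa [hu] using ha.symm
  simp only [Perm.mul_apply, swap_apply_of_ne_of_ne h1 h2] at hv ⊢
  exact h.2 v hv

omit [Fintype V] in
-- Rotation: the matching edge at `y` is exchanged for the edge from `y` to the unmatched vertex
-- `u`, which frees the old partner of `y`. Conjugation makes it evident that the size is unchanged.
theorem conj_swap (h : IsMatchingPerm G τ) {u y : V} (hu : τ u = u) (ha : G.Adj u y) (hy : τ y ≠ y) :
    IsMatchingPerm G (swap u (τ y) * τ * (swap u (τ y))⁻¹) := by
  have hyu : y ≠ u := ha.ne'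
  have h1 := h.1
  refine ⟨fun v => by simp [h.1], fun v hv => ?_⟩
  by_cases e1 : v = u
  · subst e1
    simpa [h.1, swap_apply_of_ne_of_ne hyu hy.symm] using ha
  by_cases e2 : v = τ y
  · subst e2; simp [hu] at hv
  by_cases e3 : v = y
  · subst e3
    simpa [swap_apply_of_ne_of_ne hyu hy.symm] using ha.symm
  have e4 : τ v ≠ u := fun e => e1 (by rw [← h.1 v, e, hu])
  have e5 : τ v ≠ τ y := fun e => e3 (τ.injective e)
  simp only [Perm.mul_apply, swap_inv, swap_apply_of_ne_of_ne e1 e2, swap_apply_of_ne_of_ne e4 e5]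
    at hv ⊢
  exact h.2 v hv

theorem not_adj_of_max (h : IsMatchingPerm G τ)
    (hmax : ∀ σ, IsMatchingPerm G σ → σ.support.card ≤ τ.support.card) {u w : V}
    (hu : τ u = u) (hw : τ w = w) : ¬ G.Adj u w := fun ha => by
  have := hmax _ (h.mul_swap hu hw ha)
  rw [card_support_mul_swap ha.ne hu hw] at this
  omega

/-- If a neighbor `y` of `u` had its partner `τ y` adjacent to `v`, then `u, y, τ y, v` would be an
augmenting path. So `τ` maps the neighbors of `u` to matched vertices not adjacent to `v`, and the
two sets fit disjointly into the support. -/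
theorem degree_add_degree_le [DecidableRel G.Adj] (h : IsMatchingPerm G τ)
    (hmax : ∀ σ, IsMatchingPerm G σ → σ.support.card ≤ τ.support.card) {u v : V} (huv : u ≠ v)
    (hu : τ u = u) (hv : τ v = v) : G.degree u + G.degree v ≤ τ.support.card := by
  have hsub : ∀ w, τ w = w → ∀ x, G.Adj w x → τ x ≠ x := fun w hw x hx hx' =>
    h.not_adj_of_max hmax hw hx' hx
  have hd : Disjoint ((G.neighborFinset u).map τ.toEmbedding) (G.neighborFinset v) := by
    rw [Finset.disjoint_left]
    intro x hx hx'
    simp only [Finset.mem_map, SimpleGraph.mem_neighborFinset] at hx hx'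
    obtain ⟨y, hy, rfl⟩ := hx
    have hyy := hsub u hu y hy
    have e : τ y ≠ u := fun e => hyy (by rw [e, ← hu, ← e, h.1])
    have hc := h.conj_swap hu hy hyy
    have e' : v ≠ τ y := fun e => hx'.ne e
    refine hc.not_adj_of_max ?_ (u := v) (w := τ y) ?_ ?_ hx'
    · intro σ hσ
      rw [Perm.card_support_conj]
      exact hmax σ hσ
    · simp [swap_apply_of_ne_of_ne huv.symm e', hv]
    · simp [hu]
  rw [← G.card_neighborFinset_eq_degree u, ← G.card_neighborFinset_eq_degree v,
    ← Finset.card_map τ.toEmbedding, ← Finset.card_union_of_disjoint hd]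
  apply Finset.card_le_card
  intro x hx
  rw [Perm.mem_support]
  simp only [Finset.mem_union, Finset.mem_map, SimpleGraph.mem_neighborFinset] at hx
  rcases hx with ⟨y, hy, rfl⟩ | hx
  · intro e
    exact hsub u hu y hy (τ.injective e)
  · exact hsub v hv x hx

theorem exists_max (G : SimpleGraph V) : ∃ τ : Equiv.Perm V, IsMatchingPerm G τ ∧
    ∀ σ, IsMatchingPerm G σ → σ.support.card ≤ τ.support.card := by
  classical
  obtain ⟨τ, hτ, hm⟩ := Finset.exists_max_image
    (Finset.univ.filter fun σ : Equiv.Perm V => IsMatchingPerm G σ) (fun σ => σ.support.card)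
    ⟨1, by simp [one]⟩
  simp only [Finset.mem_filter, Finset.mem_univ, true_and] at hτ hm
  exact ⟨τ, hτ, hm⟩

end IsMatchingPerm

/-! ### Edge-maximal graphs with bounded matching number. -/

namespace SimpleGraph

open Equiv

variable {V : Type*} [Fintype V] [DecidableEq V]

/-- A graph can be enlarged, keeping a bound on its matchings, so that non-adjacent vertices have a
small degree sum. -/
theorem exists_matching_closure (P : SimpleGraph V) {S : ℕ} (hS : Even S)
    (hP : ∀ σ, IsMatchingPerm P σ → σ.support.card ≤ S) :
    ∃ H : SimpleGraph V, P ≤ H ∧ (∀ σ, IsMatchingPerm H σ → σ.support.card ≤ S) ∧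
      ∀ (_ : DecidableRel H.Adj) (u v : V), u ≠ v → ¬ H.Adj u v → H.degree u + H.degree v ≤ S := by
  classical
  obtain ⟨H, hPH, hH⟩ := Finite.exists_le_maximal
    (p := fun H : SimpleGraph V => ∀ σ, IsMatchingPerm H σ → σ.support.card ≤ S) hP
  refine ⟨H, hPH, hH.prop, fun _ u v huv hn => ?_⟩
  have hlt : ¬ (H ⊔ edge u v ≤ H) := fun hle => hn (hle (Or.inr (by simp [edge_adj, huv])))
  have hex : ¬ ∀ σ, IsMatchingPerm (H ⊔ edge u v) σ → σ.support.card ≤ S := fun hall =>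
    hlt (hH.le_of_ge hall le_sup_left)
  push Not at hex
  obtain ⟨σ, hσ, hσS⟩ := hex
  -- A matching that exceeds the bound after adding `uv` must use `uv`; deleting that edge leaves a
  -- matching `τ` of `H` missing both `u` and `v`.
  have huse : σ u = v := by
    by_contra hne
    have : IsMatchingPerm H σ := by
      refine ⟨hσ.1, fun w hw => ?_⟩
      rcases hσ.2 w hw with h | h
      · exact h
      · rw [edge_adj] at h
        rcases h.1 with ⟨rfl, h2⟩ | ⟨rfl, h2⟩
        · exact absurd h2.symm (fun e => hne e.symm)
        · exact absurd (by rw [← h2, hσ.1]) hne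
    have := hH.prop σ this
    omega
  have huse' : σ v = u := by rw [← huse, hσ.1]
  set τ := σ * swap u v with hτ
  have hτu : τ u = u := by simp [hτ, huse']
  have hτv : τ v = v := by simp [hτ, huse]
  have hτx : ∀ x, x ≠ u → x ≠ v → τ x = σ x := fun x h1 h2 => by
    simp [hτ, swap_apply_of_ne_of_ne h1 h2]
  have hτm : IsMatchingPerm H τ := by
    constructor
    · intro x
      by_cases h1 : x = u
      · rw [h1, hτu, hτu]
      by_cases h2 : x = v
      · rw [h2, hτv, hτv]
      rw [hτx x h1 h2, hτx, hσ.1]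
      · intro e; exact h2 (by rw [← huse, ← e, hσ.1])
      · intro e; exact h1 (by rw [← huse', ← e, hσ.1])
    · intro x hx
      by_cases h1 : x = u
      · exact absurd (h1 ▸ hτu) hx
      by_cases h2 : x = v
      · exact absurd (h2 ▸ hτv) hx
      rw [hτx x h1 h2] at hx ⊢
      rcases hσ.2 x hx with h | h
      · exact h
      · rw [edge_adj] at h
        rcases h.1 with ⟨h3, _⟩ | ⟨h3, _⟩
        · exact absurd h3 h1
        · exact absurd h3 h2
  have hcard : τ.support.card + 2 = σ.support.card := by
    rw [← IsMatchingPerm.card_support_mul_swap huv hτu hτv, hτ, mul_assoc, swap_mul_self, mul_one]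
  have hτS : τ.support.card ≤ S := hH.prop τ hτm
  have hev := IsMatchingPerm.even_card_support hτm.1
  -- By parity the oversized matching covers at least `S + 2` vertices, so `τ` covers exactly `S`
  -- and is a maximum matching of `H`.
  have hge : S ≤ τ.support.card := by
    obtain ⟨a, ha⟩ := hev
    obtain ⟨b, hb⟩ := hS
    omega
  exact (hτm.degree_add_degree_le (fun ρ hρ => (hH.prop ρ hρ).trans hge) huv hτu hτv).trans hτS

end SimpleGraph

/-! ### The Erdős–Gallai bound. -/

namespace SimpleGraph

open Equiv

variable {V : Type*} [Fintype V] [DecidableEq V]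

theorem card_le_of_complete {H : SimpleGraph V} {s : ℕ} (hc : ∀ u v, u ≠ v → H.Adj u v)
    (hH : ∀ σ, IsMatchingPerm H σ → σ.support.card ≤ 2 * s) : Fintype.card V ≤ 2 * s + 1 := by
  obtain ⟨τ, hτ, hm⟩ := IsMatchingPerm.exists_max H
  by_contra hlt
  have h1 := hH τ hτ
  have h2 := Finset.card_compl τ.support
  obtain ⟨u, hu, v, hv, huv⟩ := Finset.one_lt_card.1 (show 1 < (τ.support)ᶜ.card by omega)
  simp only [Finset.mem_compl, Perm.mem_support, not_not] at hu hv
  exact hτ.not_adj_of_max hm hu hv (hc u v huv)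

/-- Here `a` counts the vertices of degree above `s`, `δ` is the largest degree among the others,
attained at `v`, and `b` counts the neighbors of `v` among the `a`. When `b < a`, the worst case is
`b = δ`, `a = 2s - δ + 1`, which leaves a convex quadratic in `δ` on `[0, s]`; its endpoint values
are the clique and the star bound. -/
theorem degree_sum_bound_arith {n s δ a b : ℤ} (hδ : 0 ≤ δ) (hδs : δ ≤ s) (hn : 2 * s ≤ n)
    (hn1 : 1 ≤ n) (hb : 0 ≤ b) (hbδ : b ≤ δ) (hba : b ≤ a) (hab : b < a → a ≤ 2 * s - δ + 1) :
    (n - a) * δ + b * (n - 1) + (a - b) * (2 * s - δ) ≤ 2 * s * (2 * s + 1) ∨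
    (n - a) * δ + b * (n - 1) + (a - b) * (2 * s - δ) ≤ s * (2 * n - s - 1) := by
  rcases hba.eq_or_lt with rfl | hlt
  · right
    nlinarith [mul_nonneg (sub_nonneg.2 hbδ) (show 0 ≤ n - 1 - δ + s by omega), mul_nonneg (sub_nonneg.2 hδs) (show 0 ≤ 2 * n - 1 - s - δ by omega)]
  · have ha := hab hlt
    have h1 : (n - a) * δ + b * (n - 1) + (a - b) * (2 * s - δ) ≤
        2 * n * δ - 3 * δ - 8 * s * δ + 3 * δ ^ 2 + 4 * s ^ 2 + 2 * s := by
      have h2 : b * (n - 1 - 2 * s + δ) ≤ δ * (n - 1 - 2 * s + δ) := by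
        rcases hδ.eq_or_lt with h | h
        · have : b = δ := by omega
          rw [this]
        · exact mul_le_mul_of_nonneg_right hbδ (by omega)
      have h3 : a * (2 * s - 2 * δ) ≤ (2 * s - δ + 1) * (2 * s - 2 * δ) :=
        mul_le_mul_of_nonneg_right ha (by omega)
      nlinarith
    -- This expression times `δ` is the value of the quadratic at `δ` minus its value at `0`.
    rcases le_total (2 * n - 3 - 8 * s + 3 * δ) 0 with h | h
    · left
      nlinarith [mul_nonneg hδ (neg_nonneg.2 h)]
    · right
      nlinarith [mul_nonneg (sub_nonneg.2 hδs) (show 0 ≤ 2 * n - 3 - 8 * s + 3 * (s + δ) by omega)]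

/-- The Erdős–Gallai bound on the number of edges of a graph whose matchings have size at most
`s`. -/
theorem sum_degree_le_of_matching_le (P : SimpleGraph V) [DecidableRel P.Adj] [Nonempty V] {s : ℕ}
    (hs : 2 * s ≤ Fintype.card V)
    (hP : ∀ σ, IsMatchingPerm P σ → σ.support.card ≤ 2 * s) :
    (∑ v, (P.degree v : ℤ)) ≤ 2 * s * (2 * s + 1) ∨
      (∑ v, (P.degree v : ℤ)) ≤ s * (2 * (Fintype.card V : ℤ) - s - 1) := by
  classical
  obtain ⟨H, hPH, hH, hdeg⟩ := exists_matching_closure P (even_two_mul s) hP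
  have hle : ∑ v, (P.degree v : ℤ) ≤ ∑ v, (H.degree v : ℤ) :=
    Finset.sum_le_sum fun v _ => by exact_mod_cast degree_le_of_le hPH
  have hn1 : 1 ≤ Fintype.card V := Fintype.card_pos
  have hlt : ∀ v, (H.degree v : ℤ) ≤ (Fintype.card V : ℤ) - 1 := fun v => by
    have := H.degree_lt_card_verts v
    omega
  set n := Fintype.card V with hn
  -- Two vertices of `A` have degree sum above `2s`, so the closure property makes `A` a clique.
  set A : Finset V := Finset.univ.filter fun v => s + 1 ≤ H.degree v with hA
  have hclique : ∀ u ∈ A, ∀ v ∈ A, u ≠ v → H.Adj u v := fun u hu v hv huv => by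
    by_contra hn
    have := hdeg inferInstance u v huv hn
    simp only [hA, Finset.mem_filter, Finset.mem_univ, true_and] at hu hv
    omega
  rcases (Aᶜ).eq_empty_or_nonempty with he | hne
  · left
    have hall : ∀ v, v ∈ A := fun v => by
      by_contra hv
      have : v ∈ Aᶜ := Finset.mem_compl.2 hv
      simp [he] at this
    have hc := card_le_of_complete (fun u v => hclique u (hall u) v (hall v)) hH
    calc _ ≤ ∑ v, (H.degree v : ℤ) := hle
      _ ≤ ∑ v : V, ((n : ℤ) - 1) := Finset.sum_le_sum fun v _ => hlt v
      _ = n * ((n : ℤ) - 1) := by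
        rw [Finset.sum_const, Finset.card_univ, nsmul_eq_mul]
      _ ≤ _ := by
        have : (n : ℤ) ≤ 2 * s + 1 := by exact_mod_cast hc
        nlinarith
  obtain ⟨v, hvA, hvmax⟩ := Finset.exists_max_image Aᶜ (fun v => H.degree v) hne
  set δ := H.degree v with hδ
  have hvA' : δ ≤ s := by
    simp only [hA, Finset.mem_compl, Finset.mem_filter, Finset.mem_univ, true_and] at hvA
    omega
  set B := A.filter fun x => H.Adj v x with hB
  set C := A.filter fun x => ¬ H.Adj v x with hC
  have hBC : B.card + C.card = A.card := Finset.card_filter_add_card_filter_not _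
  have hBδ : B.card ≤ δ := by
    rw [hδ, ← card_neighborFinset_eq_degree]
    exact Finset.card_le_card fun x hx => by simpa using (Finset.mem_filter.1 hx).2
  have hCdeg : ∀ x ∈ C, (H.degree x : ℤ) ≤ 2 * s - δ := fun x hx => by
    simp only [hC, Finset.mem_filter] at hx
    have hxv : v ≠ x := fun e => (Finset.mem_compl.1 hvA) (e ▸ hx.1)
    have := hdeg inferInstance v x hxv hx.2
    omega
  have hsum : ∑ v, (H.degree v : ℤ) =
      ∑ x ∈ Aᶜ, (H.degree x : ℤ) + ∑ x ∈ B, (H.degree x : ℤ) + ∑ x ∈ C, (H.degree x : ℤ) := by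
    rw [← Finset.sum_compl_add_sum A, ← Finset.sum_filter_add_sum_filter_not A (fun x => H.Adj v x)]
    ring
  have hbound : ∑ v, (H.degree v : ℤ) ≤ ((n : ℤ) - A.card) * δ + B.card * ((n : ℤ) - 1) +
      ((A.card : ℤ) - B.card) * (2 * s - δ) := by
    rw [hsum]
    have h1 : ∑ x ∈ Aᶜ, (H.degree x : ℤ) ≤ (Aᶜ).card • (δ : ℤ) :=
      Finset.sum_le_card_nsmul _ _ _ fun x hx => by exact_mod_cast hvmax x hx
    have h2 : ∑ x ∈ B, (H.degree x : ℤ) ≤ B.card • ((n : ℤ) - 1) :=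
      Finset.sum_le_card_nsmul _ _ _ fun x _ => hlt x
    have h3 : ∑ x ∈ C, (H.degree x : ℤ) ≤ C.card • (2 * s - δ : ℤ) :=
      Finset.sum_le_card_nsmul _ _ _ hCdeg
    have h4 : ((Aᶜ).card : ℤ) = n - A.card := by
      have := Finset.card_compl_add_card A
      omega
    have h5 : (C.card : ℤ) = A.card - B.card := by omega
    simp only [nsmul_eq_mul, h4, h5] at h1 h2 h3
    linarith
  -- A vertex of `C` is adjacent to the rest of the clique `A` but has degree at most `2s - δ`; this
  -- bounds the size of `A`.
  have harith := degree_sum_bound_arith (n := n) (s := s) (δ := δ) (a := A.card) (b := B.card)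
    (by omega) (by omega) (by omega) (by omega) (by omega) (by omega) (by omega) (fun hlt' => by
      have hCpos : 0 < C.card := by omega
      obtain ⟨x, hx⟩ := Finset.card_pos.1 hCpos
      have h1 := hCdeg x hx
      have hxA : x ∈ A := (Finset.mem_filter.1 hx).1
      have h2 : (A.erase x).card ≤ H.degree x := by
        rw [← card_neighborFinset_eq_degree]
        refine Finset.card_le_card fun y hy => ?_
        rw [Finset.mem_erase] at hy
        rw [mem_neighborFinset]
        exact hclique x hxA y hy.2 hy.1.symm
      rw [Finset.card_erase_of_mem hxA] at h2
      omega)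
  exact harith.imp (hle.trans hbound).trans (hle.trans hbound).trans

end SimpleGraph

/-! ### Averaging over the centralizer of an involution. -/

section Averaging

open Equiv Finset

theorem card_mul_sum_smul_eq {Γ X : Type*} [Group Γ] [Fintype Γ] [MulAction Γ X] (A : Finset X)
    (hinv : ∀ γ : Γ, ∀ x ∈ A, γ • x ∈ A) (htr : ∀ x ∈ A, ∀ y ∈ A, ∃ γ : Γ, γ • x = y)
    (f : X → ℝ) {x : X} (hx : x ∈ A) :
    (A.card : ℝ) * ∑ γ : Γ, f (γ • x) = Fintype.card Γ * ∑ y ∈ A, f y := by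
  have h1 : ∀ y ∈ A, ∑ γ : Γ, f (γ • y) = ∑ γ : Γ, f (γ • x) := fun y hy => by
    obtain ⟨δ, rfl⟩ := htr x hx y hy
    simp_rw [← mul_smul]
    exact Fintype.sum_equiv (Equiv.mulRight δ) _ _ fun γ => rfl
  have h2 : ∀ γ : Γ, ∑ y ∈ A, f (γ • y) = ∑ y ∈ A, f y := fun γ =>
    Finset.sum_nbij' (γ • ·) (γ⁻¹ • ·) (hinv γ) (hinv γ⁻¹) (by simp) (by simp) (by simp)
  calc (A.card : ℝ) * ∑ γ : Γ, f (γ • x) = ∑ y ∈ A, ∑ γ : Γ, f (γ • y) := by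
        rw [sum_congr rfl h1, sum_const, nsmul_eq_mul]
    _ = ∑ γ : Γ, ∑ y ∈ A, f (γ • y) := sum_comm
    _ = _ := by simp [h2]

/-- A random group element sends each point uniformly over the orbit `A`, so `g` and the translated
`f` become uncorrelated on `A`. -/
theorem sum_sum_mul_smul_eq {Γ X : Type*} [Group Γ] [Fintype Γ] [MulAction Γ X] (A : Finset X)
    (hinv : ∀ γ : Γ, ∀ x ∈ A, γ • x ∈ A) (htr : ∀ x ∈ A, ∀ y ∈ A, ∃ γ : Γ, γ • x = y)
    (g f : X → ℝ) :
    ∑ γ : Γ, ∑ x ∈ A, g x * f (γ • x) =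
      Fintype.card Γ * ((∑ x ∈ A, g x) * (∑ x ∈ A, f x) / A.card) := by
  rcases A.eq_empty_or_nonempty with rfl | hA
  · simp
  have hc : (A.card : ℝ) ≠ 0 := by exact_mod_cast hA.card_pos.ne'
  rw [sum_comm]
  calc ∑ x ∈ A, ∑ γ : Γ, g x * f (γ • x)
      = ∑ x ∈ A, g x * (Fintype.card Γ * (∑ y ∈ A, f y) / A.card) := by
        refine sum_congr rfl fun x hx => ?_
        rw [← mul_sum, ← card_mul_sum_smul_eq A hinv htr f hx]
        field_simp
    _ = _ := by
        rw [← sum_mul]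
        ring

variable {V : Type*} [Fintype V] [DecidableEq V]

/-- The ordered pairs exchanged by `τ`. -/
def partnerPairs (τ : Perm V) : Finset (V × V) :=
  univ.filter fun p => p.1 ∈ τ.support ∧ p.2 = τ p.1

/-- The ordered pairs of moved points that are in different orbits of `τ`. -/
def nonpartnerPairs (τ : Perm V) : Finset (V × V) :=
  univ.filter fun p => p.1 ∈ τ.support ∧ p.2 ∈ τ.support ∧ p.2 ≠ p.1 ∧ p.2 ≠ τ p.1

/-- The ordered pairs of a moved point and a fixed point. -/
def outerPairs (τ : Perm V) : Finset (V × V) :=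
  univ.filter fun p => p.1 ∈ τ.support ∧ p.2 ∉ τ.support

theorem card_partnerPairs (τ : Perm V) : (partnerPairs τ).card = τ.support.card := by
  refine card_nbij' Prod.fst (fun x => (x, τ x)) ?_ ?_ ?_ ?_
  · intro p hp
    exact (mem_filter.1 hp).2.1
  · intro x hx
    exact mem_filter.2 ⟨mem_univ _, hx, rfl⟩
  · intro p hp
    exact Prod.ext rfl (mem_filter.1 hp).2.2.symm
  · intro x _
    rfl

theorem card_outerPairs (τ : Perm V) :
    (outerPairs τ).card = τ.support.card * (Fintype.card V - τ.support.card) := by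
  have : outerPairs τ = τ.support ×ˢ τ.supportᶜ := by
    ext ⟨x, y⟩
    simp [outerPairs]
  rw [this, card_product, card_compl]

theorem card_nonpartnerPairs {τ : Perm V} :
    (nonpartnerPairs τ).card = τ.support.card * (τ.support.card - 2) := by
  have : nonpartnerPairs τ = τ.support.biUnion
      fun x => ((τ.support.erase x).erase (τ x)).map ⟨fun y => (x, y), Prod.mk_right_injective x⟩ := by
    ext ⟨x, y⟩
    simp only [nonpartnerPairs, mem_filter, mem_univ, true_and, mem_biUnion, mem_map, mem_erase,
      Function.Embedding.coeFn_mk, Prod.mk.injEq]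
    constructor
    · rintro ⟨h1, h2, h3, h4⟩
      exact ⟨x, h1, y, ⟨h4, h3, h2⟩, rfl, rfl⟩
    · rintro ⟨x, h1, y, ⟨h4, h3, h2⟩, rfl, rfl⟩
      exact ⟨h1, h2, h3, h4⟩
  rw [this, card_biUnion]
  · rw [sum_const_nat (m := τ.support.card - 2)]
    intro x hx
    rw [card_map, card_erase_of_mem, card_erase_of_mem hx]
    · omega
    · exact mem_erase.2 ⟨Perm.mem_support.1 hx, Perm.apply_mem_support.2 hx⟩
  · intro x _ x' _ hne
    simp only [Function.onFun, disjoint_left, mem_map, Function.Embedding.coeFn_mk]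
    rintro _ ⟨y, _, rfl⟩ ⟨y', _, h⟩
    exact hne (Prod.ext_iff.1 h).1.symm

omit [Fintype V] in
-- Exchange the orbits `{a, τ a}` and `{b, τ b}`, partner to partner. That nothing else moves is
-- what later allows the second coordinate of a pair to be adjusted without disturbing the first.
theorem exists_commuting_perm {τ : Perm V} (hτ : ∀ v, τ (τ v) = v) {a b : V} (ha : τ a ≠ a)
    (hb : τ b ≠ b) : ∃ γ : Perm V, γ * τ = τ * γ ∧ γ a = b ∧
      ∀ x, x ≠ a → x ≠ τ a → x ≠ b → x ≠ τ b → γ x = x := by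
  by_cases h1 : b = a
  · exact ⟨1, by simp, by simp [h1], by simp⟩
  by_cases h2 : b = τ a
  · subst h2
    refine ⟨swap a (τ a), ?_, by simp, fun x h3 h4 _ _ => swap_apply_of_ne_of_ne h3 h4⟩
    rw [mul_swap_eq_swap_mul, hτ, swap_comm]
  have h3 : τ a ≠ b := fun e => h2 e.symm
  have h4 : τ b ≠ a := fun e => h2 (by rw [← e, hτ])
  have h5 : τ a ≠ τ b := fun e => h1 (τ.injective e).symm
  refine ⟨swap a b * swap (τ a) (τ b), ?_, ?_, fun x e1 e2 e3 e4 => ?_⟩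
  · have hd : Perm.Disjoint (swap a b) (swap (τ a) (τ b)) := fun x => by
      by_cases e1 : x = a
      · subst e1
        exact Or.inr (swap_apply_of_ne_of_ne ha.symm h4.symm)
      by_cases e2 : x = b
      · subst e2
        exact Or.inr (swap_apply_of_ne_of_ne h3.symm hb.symm)
      · exact Or.inl (swap_apply_of_ne_of_ne e1 e2)
    have c1 : τ * swap a b = swap (τ a) (τ b) * τ := mul_swap_eq_swap_mul ..
    have c2 : τ * swap (τ a) (τ b) = swap a b * τ := by rw [mul_swap_eq_swap_mul, hτ, hτ]
    rw [← mul_assoc τ, c1, mul_assoc _ τ, c2, ← mul_assoc, hd.commute.eq]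
  · simp [swap_apply_of_ne_of_ne ha.symm h4.symm]
  · simp [swap_apply_of_ne_of_ne e1 e3, swap_apply_of_ne_of_ne e2 e4]

theorem apply_mem_support_iff_of_commute {γ τ : Perm V} (h : γ * τ = τ * γ) (x : V) :
    γ x ∈ τ.support ↔ x ∈ τ.support := by
  have : τ (γ x) = γ (τ x) := by rw [← Perm.mul_apply, ← h, Perm.mul_apply]
  rw [Perm.mem_support, Perm.mem_support, this, γ.injective.ne_iff]

theorem sum_eq_sum_pairs {τ : Perm V} (hfix : ∀ u v, τ u = u → τ v = v → u = v) (f : V × V → ℝ)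
    (hf : ∀ x, f (x, x) = 0) :
    ∑ p, f p = ∑ p ∈ partnerPairs τ, f p + ∑ p ∈ nonpartnerPairs τ, f p +
      ∑ p ∈ outerPairs τ, f p + ∑ p ∈ outerPairs τ, f p.swap := by
  have h4 : ∑ p ∈ outerPairs τ, f p.swap =
      ∑ p ∈ univ.filter (fun p : V × V => p.1 ∉ τ.support ∧ p.2 ∈ τ.support), f p :=
    sum_nbij' Prod.swap Prod.swap (by simp +contextual [outerPairs]) (by simp +contextual [outerPairs])
      (by simp) (by simp) (by simp)
  rw [h4, partnerPairs, nonpartnerPairs, outerPairs]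
  simp only [sum_filter, ← sum_add_distrib]
  refine sum_congr rfl fun ⟨x, y⟩ _ => ?_
  by_cases hx : x ∈ τ.support <;> by_cases hy : y ∈ τ.support
  · by_cases h1 : y = x
    · subst h1
      simp [hf]
    · by_cases h2 : y = τ x <;> simp [hx, hy, h1, h2]
      simp_all
  · have : y ≠ τ x := fun e => hy (e ▸ Perm.apply_mem_support.2 hx)
    simp [hx, hy, this]
  · simp [hx, hy]
  · rw [Perm.notMem_support] at hx hy
    obtain rfl := hfix x y hx hy
    simp [hf]

/-- Averaging over the centralizer of an involution with at most one fixed point. -/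
theorem exists_perm_sum_ge {τ : Perm V} (hτ : ∀ v, τ (τ v) = v)
    (hfix : ∀ u v, τ u = u → τ v = v → u = v) (a b : V × V → ℝ) (ha : ∀ x, a (x, x) = 0)
    (ha' : ∀ p, a p.swap = a p) (hb' : ∀ p, b p.swap = b p) :
    ∃ γ : Perm V,
      (∑ p ∈ partnerPairs τ, a p) * (∑ p ∈ partnerPairs τ, b p) / (partnerPairs τ).card +
      (∑ p ∈ nonpartnerPairs τ, a p) * (∑ p ∈ nonpartnerPairs τ, b p) / (nonpartnerPairs τ).card +
      2 * ((∑ p ∈ outerPairs τ, a p) * (∑ p ∈ outerPairs τ, b p) / (outerPairs τ).card) ≤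
      ∑ p : V × V, a p * b (γ p.1, γ p.2) := by
  classical
  let Γ : Subgroup (Perm V) := Subgroup.centralizer {τ}
  have hΓ : ∀ γ : Perm V, γ ∈ Γ ↔ γ * τ = τ * γ := fun γ => by
    rw [Subgroup.mem_centralizer_singleton_iff]
  have hΓs : ∀ γ : Γ, ∀ x : V, γ • x ∈ τ.support ↔ x ∈ τ.support := fun γ x =>
    apply_mem_support_iff_of_commute ((hΓ γ).1 γ.2) x
  have hΓτ : ∀ γ : Γ, ∀ x : V, τ (γ • x) = γ • τ x := fun γ x => by
    have := (hΓ γ).1 γ.2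
    change τ (γ.1 x) = γ.1 (τ x)
    rw [← Perm.mul_apply, ← this, Perm.mul_apply]
  have h1 : ∀ x ∈ τ.support, ∀ y ∈ τ.support, ∃ γ : Γ, γ • x = y := fun x hx y hy => by
    obtain ⟨γ, hγ, hxy, _⟩ := exists_commuting_perm hτ (Perm.mem_support.1 hx) (Perm.mem_support.1 hy)
    exact ⟨⟨γ, (hΓ γ).2 hγ⟩, hxy⟩
  have key : ∀ γ : Γ, ∑ p : V × V, a p * b (γ • p) =
      ∑ p ∈ partnerPairs τ, a p * b (γ • p) + ∑ p ∈ nonpartnerPairs τ, a p * b (γ • p) +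
      ∑ p ∈ outerPairs τ, a p * b (γ • p) + ∑ p ∈ outerPairs τ, a p * b (γ • p) := fun γ => by
    rw [sum_eq_sum_pairs hfix _ (by simp [ha])]
    congr 1
    refine sum_congr rfl fun p _ => ?_
    rw [ha', ← hb' (γ • p)]
    rfl
  have e1 := sum_sum_mul_smul_eq (Γ := Γ) (partnerPairs τ) (fun γ p hp => by
      simp only [partnerPairs, mem_filter, mem_univ, true_and, Prod.smul_fst, Prod.smul_snd, hΓs,
        hΓτ] at hp ⊢
      exact ⟨hp.1, by rw [hp.2]⟩) (fun p hp q hq => by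
      simp only [partnerPairs, mem_filter, mem_univ, true_and] at hp hq
      obtain ⟨γ, hγ⟩ := h1 _ hp.1 _ hq.1
      refine ⟨γ, Prod.ext hγ ?_⟩
      rw [hq.2, ← hγ, hΓτ, ← hp.2]
      rfl) a b
  have e3 := sum_sum_mul_smul_eq (Γ := Γ) (outerPairs τ) (fun γ p hp => by
      simp only [outerPairs, mem_filter, mem_univ, true_and, Prod.smul_fst, Prod.smul_snd,
        hΓs] at hp ⊢
      exact hp) (fun p hp q hq => by
      simp only [outerPairs, mem_filter, mem_univ, true_and] at hp hq
      obtain ⟨γ, hγ⟩ := h1 _ hp.1 _ hq.1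
      refine ⟨γ, Prod.ext hγ (hfix _ _ ?_ ?_)⟩
      · exact Perm.notMem_support.1 (fun h => hp.2 ((hΓs γ p.2).1 h))
      · exact Perm.notMem_support.1 hq.2) a b
  -- Transitivity in two steps: `γ` carries the first coordinate to its target, then `δ` corrects
  -- the second. The target of the first lies in neither of the orbits moved by `δ`, so it stays
  -- fixed.
  have e2 := sum_sum_mul_smul_eq (Γ := Γ) (nonpartnerPairs τ) (fun γ p hp => by
      simp only [nonpartnerPairs, mem_filter, mem_univ, true_and, Prod.smul_fst, Prod.smul_snd,
        hΓs, hΓτ] at hp ⊢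
      exact ⟨hp.1, hp.2.1, fun e => hp.2.2.1 (MulAction.injective γ e),
        fun e => hp.2.2.2 (MulAction.injective γ e)⟩) (fun p hp q hq => by
      simp only [nonpartnerPairs, mem_filter, mem_univ, true_and] at hp hq
      obtain ⟨γ, hγ⟩ := h1 _ hp.1 _ hq.1
      have hy : γ • p.2 ∈ τ.support := (hΓs _ _).2 hp.2.1
      obtain ⟨δ, hδ, hxy, hδf⟩ := exists_commuting_perm hτ (Perm.mem_support.1 hy)
        (Perm.mem_support.1 hq.2.1)
      have n1 : γ • p.2 ≠ γ • p.1 := fun e => hp.2.2.1 (MulAction.injective γ e)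
      have n2 : γ • p.2 ≠ γ • τ p.1 := fun e => hp.2.2.2 (MulAction.injective γ e)
      rw [← hΓτ] at n2
      rw [hγ] at n1 n2
      refine ⟨⟨δ, (hΓ δ).2 hδ⟩ * γ, Prod.ext ?_ ?_⟩
      · rw [Prod.smul_fst, mul_smul, hγ]
        refine hδf _ n1.symm (fun e => n2 ?_) hq.2.2.1.symm (fun e => hq.2.2.2 ?_)
        · rw [e, hτ]
        · rw [e, hτ]
      · rw [Prod.smul_snd, mul_smul]
        exact hxy) a b
  have hex : ∃ γ ∈ (univ : Finset Γ),
      (∑ p ∈ partnerPairs τ, a p) * (∑ p ∈ partnerPairs τ, b p) / (partnerPairs τ).card +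
      (∑ p ∈ nonpartnerPairs τ, a p) * (∑ p ∈ nonpartnerPairs τ, b p) / (nonpartnerPairs τ).card +
      2 * ((∑ p ∈ outerPairs τ, a p) * (∑ p ∈ outerPairs τ, b p) / (outerPairs τ).card) ≤
      ∑ p : V × V, a p * b (γ • p) := by
    refine exists_le_of_sum_le univ_nonempty (le_of_eq ?_)
    simp only [key, sum_add_distrib, e1, e2, e3, sum_const, card_univ, nsmul_eq_mul]
    ring
  obtain ⟨γ, _, hγ⟩ := hex
  exact ⟨γ, hγ⟩

end Averaging

/-! ### Almost perfect matchings and edge counts over ordered pairs. -/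

section NearPerfect

open Equiv Finset

variable {V : Type*} [Fintype V] [DecidableEq V]

/-- Take an extension of largest support that fixes `Z`: two further fixed points could be swapped.
The set `Z` makes it possible to prescribe the unmatched vertex when the order is odd. -/
theorem exists_involution_extension {τ : Perm V} (hτ : ∀ v, τ (τ v) = v) (Z : Finset V)
    (hZ : ∀ z ∈ Z, τ z = z) : ∃ σ : Perm V, (∀ v, σ (σ v) = v) ∧ (∀ v, τ v ≠ v → σ v = τ v) ∧
      (∀ z ∈ Z, σ z = z) ∧ ∀ u v, u ∉ Z → v ∉ Z → σ u = u → σ v = v → u = v := by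
  classical
  obtain ⟨σ, hσ, hm⟩ := Finset.exists_max_image
    (univ.filter fun σ : Perm V => (∀ v, σ (σ v) = v) ∧ (∀ v, τ v ≠ v → σ v = τ v) ∧
      ∀ z ∈ Z, σ z = z) (fun σ => σ.support.card) ⟨τ, by simpa [hτ] using hZ⟩
  simp only [mem_filter, mem_univ, true_and] at hσ hm
  obtain ⟨h1, h2, h3⟩ := hσ
  refine ⟨σ, h1, h2, h3, fun u v hu hv hσu hσv => ?_⟩
  by_contra huv
  have := hm (σ * swap u v) ⟨IsMatchingPerm.involutive_mul_swap h1 hσu hσv, fun x hx => ?_,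
    fun z hz => ?_⟩
  · rw [IsMatchingPerm.card_support_mul_swap huv hσu hσv] at this
    omega
  · have e1 : x ≠ u := fun e => hx (by rw [← h2 x hx, e, hσu])
    have e2 : x ≠ v := fun e => hx (by rw [← h2 x hx, e, hσv])
    rw [Perm.mul_apply, swap_apply_of_ne_of_ne e1 e2, h2 x hx]
  · have e1 : z ≠ u := fun e => hu (e ▸ hz)
    have e2 : z ≠ v := fun e => hv (e ▸ hz)
    rw [Perm.mul_apply, swap_apply_of_ne_of_ne e1 e2, h3 z hz]

theorem cycleType_eq_replicate_two {τ : Perm V} (hτ : ∀ v, τ (τ v) = v) :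
    τ.cycleType = Multiset.replicate (τ.support.card / 2) 2 := by
  have h2 : ∀ c ∈ τ.cycleType, c = 2 := by
    rw [← Perm.pow_prime_eq_one_iff]
    ext v
    simp [sq, hτ]
  have h3 := Multiset.eq_replicate_card.2 h2
  have h4 := τ.sum_cycleType
  rw [h3, Multiset.sum_replicate, smul_eq_mul] at h4
  rw [← h4, Nat.mul_div_cancel _ two_pos]
  exact h3

theorem card_support_add_mod_two {τ : Perm V} (hτ : ∀ v, τ (τ v) = v)
    (hfix : ∀ u v, τ u = u → τ v = v → u = v) :
    τ.support.card + Fintype.card V % 2 = Fintype.card V := by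
  have h1 := card_compl_add_card τ.support
  have h2 : (τ.supportᶜ).card ≤ 1 := card_le_one.2 fun u hu v hv => by
    simp only [mem_compl, Perm.mem_support, not_not] at hu hv
    exact hfix u v hu hv
  obtain ⟨k, hk⟩ := IsMatchingPerm.even_card_support hτ
  omega

/-- The parity of the order decides whether there is a fixed point, so both involutions have the
same cycle type. -/
theorem exists_conj_of_near_perfect {σ τ : Perm V} (hσ : ∀ v, σ (σ v) = v)
    (hσf : ∀ u v, σ u = u → σ v = v → u = v) (hτ : ∀ v, τ (τ v) = v)
    (hτf : ∀ u v, τ u = u → τ v = v → u = v) : ∃ π : Perm V, ∀ x, π (σ x) = τ (π x) := by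
  have h1 := card_support_add_mod_two hσ hσf
  have h2 := card_support_add_mod_two hτ hτf
  have h3 : IsConj σ τ := by
    rw [Perm.isConj_iff_cycleType_eq, cycleType_eq_replicate_two hσ, cycleType_eq_replicate_two hτ]
    congr 2
    omega
  obtain ⟨π, hπ⟩ := isConj_iff.1 h3
  exact ⟨π, fun x => by rw [← hπ]; simp⟩

/-- The indicator function of the adjacency relation. -/
noncomputable def adjInd (G : SimpleGraph V) (p : V × V) : ℝ :=
  open Classical in if G.Adj p.1 p.2 then 1 else 0

omit [Fintype V] [DecidableEq V] in
theorem adjInd_self (G : SimpleGraph V) (x : V) : adjInd G (x, x) = 0 := by simp [adjInd]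

omit [Fintype V] [DecidableEq V] in
theorem adjInd_swap (G : SimpleGraph V) (p : V × V) : adjInd G p.swap = adjInd G p := by
  
  have := G.adj_comm p.2 p.1
  by_cases h : G.Adj p.1 p.2 <;> simp [adjInd, this, h]

omit [Fintype V] [DecidableEq V] in
theorem adjInd_nonneg (G : SimpleGraph V) (p : V × V) : 0 ≤ adjInd G p := by
  unfold adjInd; split_ifs <;> simp

omit [Fintype V] [DecidableEq V] in
theorem adjInd_le_one (G : SimpleGraph V) (p : V × V) : adjInd G p ≤ 1 := by
  unfold adjInd; split_ifs <;> simp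

omit [Fintype V] [DecidableEq V] in
theorem adjInd_of_adj {G : SimpleGraph V} {x y : V} (h : G.Adj x y) : adjInd G (x, y) = 1 := by
  simp [adjInd, h]

omit [DecidableEq V] in
theorem sum_adjInd_right (G : SimpleGraph V) [DecidableRel G.Adj] (x : V) :
    ∑ y, adjInd G (x, y) = G.degree x := by
  have h : ∀ y, adjInd G (x, y) = if G.Adj x y then 1 else 0 := fun y => by simp [adjInd]
  simp only [h]
  rw [sum_boole, ← G.card_neighborFinset_eq_degree]
  congr 2
  ext y
  simp

omit [DecidableEq V] in
theorem sum_adjInd_eq_sum_degree (G : SimpleGraph V) [DecidableRel G.Adj] :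
    ∑ p, adjInd G p = ∑ x, (G.degree x : ℝ) := by
  rw [Fintype.sum_prod_type]
  simp only [sum_adjInd_right]

omit [DecidableEq V] in
theorem sum_adjInd (G : SimpleGraph V) : ∑ p, adjInd G p = 2 * (G.edgeSet.ncard : ℝ) := by
  classical
  rw [sum_adjInd_eq_sum_degree, ← Nat.cast_sum, G.sum_degrees_eq_twice_card_edges,
    ← G.coe_edgeFinset, Set.ncard_coe_finset]
  push_cast
  rfl

theorem sum_partnerPairs (τ : Perm V) (f : V × V → ℝ) :
    ∑ p ∈ partnerPairs τ, f p = ∑ x ∈ τ.support, f (x, τ x) :=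
  sum_nbij' Prod.fst (fun x => (x, τ x)) (fun p hp => (mem_filter.1 hp).2.1)
    (fun x hx => mem_filter.2 ⟨mem_univ _, hx, rfl⟩)
    (fun p hp => Prod.ext rfl (mem_filter.1 hp).2.2.symm) (fun x _ => rfl)
    (fun p hp => by rw [← (mem_filter.1 hp).2.2])

theorem sum_outerPairs (τ : Perm V) (f : V × V → ℝ) :
    ∑ p ∈ outerPairs τ, f p = ∑ x ∈ τ.support, ∑ y ∈ τ.supportᶜ, f (x, y) := by
  have : outerPairs τ = τ.support ×ˢ τ.supportᶜ := by
    ext ⟨x, y⟩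
    simp [outerPairs]
  rw [this, sum_product]

theorem card_support_le_sum_partnerPairs {G : SimpleGraph V} {τ σ : Perm V}
    (h : IsMatchingPerm G τ) (hσ : ∀ v, τ v ≠ v → σ v = τ v) :
    (τ.support.card : ℝ) ≤ ∑ p ∈ partnerPairs σ, adjInd G p := by
  rw [sum_partnerPairs, card_eq_sum_ones, Nat.cast_sum]
  have hsub : τ.support ⊆ σ.support := fun x hx => by
    rw [Perm.mem_support] at hx ⊢
    rwa [hσ x hx]
  refine le_trans (le_of_eq (sum_congr rfl fun x hx => ?_))
    (sum_le_sum_of_subset_of_nonneg hsub fun x _ _ => adjInd_nonneg _ _)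
  rw [Perm.mem_support] at hx
  rw [hσ x hx, adjInd_of_adj (h.2 x hx), Nat.cast_one]

/-- A graph of bounded degree has few edges in terms of the size of its maximum matchings. -/
theorem sum_adjInd_add_card_support_le {G : SimpleGraph V} [DecidableRel G.Adj] {τ : Perm V}
    (h : IsMatchingPerm G τ) (hmax : ∀ σ, IsMatchingPerm G σ → σ.support.card ≤ τ.support.card)
    {Δ : ℕ} (hΔ : ∀ v, G.degree v ≤ Δ) :
    ∑ p, adjInd G p + τ.support.card ≤ 2 * Δ * τ.support.card := by
  have hdeg : ∑ x ∈ τ.support, ∑ y, adjInd G (x, y) ≤ Δ * τ.support.card := by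
    simp only [sum_adjInd_right]
    calc _ ≤ ∑ x ∈ τ.support, (Δ : ℝ) := sum_le_sum fun x _ => by exact_mod_cast hΔ x
      _ = _ := by rw [sum_const, nsmul_eq_mul, mul_comm]
  -- By maximality every edge meets the support, and a matching edge meets it at both ends; this
  -- surplus is the term added on the left.
  have hpt : ∀ x y, adjInd G (x, y) + (if x ∈ τ.support ∧ y = τ x then (1 : ℝ) else 0) ≤
      (if x ∈ τ.support then adjInd G (x, y) else 0) +
      (if y ∈ τ.support then adjInd G (y, x) else 0) := fun x y => by
    have hs : adjInd G (y, x) = adjInd G (x, y) := adjInd_swap G (x, y)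
    have h0 := adjInd_nonneg G (x, y)
    rw [hs]
    by_cases hx : x ∈ τ.support
    · by_cases hy : y = τ x
      · subst hy
        have := adjInd_of_adj (h.2 x (Perm.mem_support.1 hx))
        simp only [hx, Perm.apply_mem_support, and_self, if_true, this]
        exact le_rfl
      · simp only [hx, hy, and_false, if_true, if_false, add_zero]
        split_ifs <;> linarith
    · by_cases hy : y ∈ τ.support
      · simp [hx, hy]
      · have hn := h.not_adj_of_max hmax (Perm.notMem_support.1 hx) (Perm.notMem_support.1 hy)
        simp [adjInd, hx, hn]
  have hsum := sum_le_sum fun x (_ : x ∈ (univ : Finset V)) =>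
    sum_le_sum fun y (_ : y ∈ (univ : Finset V)) => hpt x y
  simp only [sum_add_distrib] at hsum
  have e1 : ∑ x, ∑ y, (if x ∈ τ.support ∧ y = τ x then (1 : ℝ) else 0) = τ.support.card := by
    have : ∀ x, ∑ y, (if x ∈ τ.support ∧ y = τ x then (1 : ℝ) else 0) =
        if x ∈ τ.support then 1 else 0 := fun x => by split_ifs with hx <;> simp [hx]
    simp only [this]
    rw [sum_ite_mem, univ_inter, sum_const, nsmul_eq_mul, mul_one]
  have e2 : ∑ x, ∑ y, (if x ∈ τ.support then adjInd G (x, y) else 0) =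
      ∑ x ∈ τ.support, ∑ y, adjInd G (x, y) := by
    have : ∀ x, ∑ y, (if x ∈ τ.support then adjInd G (x, y) else 0) =
        if x ∈ τ.support then ∑ y, adjInd G (x, y) else 0 := fun x => by split_ifs <;> simp
    simp only [this]
    rw [sum_ite_mem, univ_inter]
  have e3 : ∑ x, ∑ y, (if y ∈ τ.support then adjInd G (y, x) else 0) =
      ∑ x ∈ τ.support, ∑ y, adjInd G (x, y) := by
    rw [sum_comm, e2]
  rw [e1, e2, e3] at hsum
  rw [Fintype.sum_prod_type]
  linarith

end NearPerfect

/-! ### Almost perfect matchings adapted to the host and to the guest. -/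

section Hosts

open Equiv Finset

variable {V : Type*} [Fintype V] [DecidableEq V]

theorem support_eq_univ_of_even {τ : Perm V} (hτ : ∀ v, τ (τ v) = v)
    (hfix : ∀ u v, τ u = u → τ v = v → u = v) (hV : Even (Fintype.card V)) : τ.support = univ := by
  have := card_support_add_mod_two hτ hfix
  rw [Nat.even_iff] at hV
  exact card_eq_iff_eq_univ _ |>.1 (by omega)

theorem outerPairs_eq_empty_of_even {τ : Perm V} (hτ : ∀ v, τ (τ v) = v)
    (hfix : ∀ u v, τ u = u → τ v = v → u = v) (hV : Even (Fintype.card V)) : outerPairs τ = ∅ := by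
  have h := support_eq_univ_of_even hτ hfix hV
  ext p
  simp only [outerPairs, h]
  simp

/-- The host graph has an almost perfect matching containing a maximum matching. -/
theorem exists_near_perfect_of_host (P : SimpleGraph V) [Nonempty V] :
    ∃ (τ : Perm V) (s : ℕ), (∀ v, τ (τ v) = v) ∧ (∀ u v, τ u = u → τ v = v → u = v) ∧
      2 * s ≤ Fintype.card V ∧ (2 * s : ℝ) ≤ ∑ p ∈ partnerPairs τ, adjInd P p ∧
      (∑ p, adjInd P p ≤ 2 * s * (2 * s + 1) ∨
        ∑ p, adjInd P p ≤ s * (2 * (Fintype.card V : ℝ) - s - 1)) := by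
  classical
  obtain ⟨τ, hτ, hm⟩ := IsMatchingPerm.exists_max P
  obtain ⟨s, hs⟩ := (even_iff_exists_two_mul).1 (IsMatchingPerm.even_card_support hτ.1)
  obtain ⟨σ, h1, h2, _, h4⟩ := exists_involution_extension hτ.1 ∅ (by simp)
  have hle : 2 * s ≤ Fintype.card V := hs ▸ card_le_univ τ.support
  refine ⟨σ, s, h1, fun u v => h4 u v (by simp) (by simp), hle, ?_, ?_⟩
  · have := card_support_le_sum_partnerPairs hτ h2
    rw [hs] at this
    exact_mod_cast this
  · rw [hs] at hm
    rw [sum_adjInd_eq_sum_degree]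
    have := P.sum_degree_le_of_matching_le hle hm
    exact_mod_cast this

/-- A graph of bounded degree has an almost perfect matching of the vertices that contains many of
its edges, and misses at most a vertex of small degree. -/
theorem exists_near_perfect_of_guest (G : SimpleGraph V) [DecidableRel G.Adj] {Δ : ℕ}
    (hΔ : ∀ v, G.degree v ≤ Δ) (hV : 2 ≤ Fintype.card V) :
    ∃ σ : Perm V, (∀ v, σ (σ v) = v) ∧ (∀ u v, σ u = u → σ v = v → u = v) ∧
      ∑ p, adjInd G p ≤ (2 * Δ + 1) * ∑ p ∈ partnerPairs σ, adjInd G p ∧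
      Fintype.card V * ∑ p ∈ outerPairs σ, adjInd G p ≤ ∑ p, adjInd G p := by
  classical
  have htot : 0 ≤ ∑ p, adjInd G p := sum_nonneg fun p _ => adjInd_nonneg G p
  rcases Nat.even_or_odd (Fintype.card V) with hpar | hpar
  · obtain ⟨τ, hτ, hm⟩ := IsMatchingPerm.exists_max G
    obtain ⟨σ, h1, h2, _, h4⟩ := exists_involution_extension hτ.1 ∅ (by simp)
    have hf : ∀ u v, σ u = u → σ v = v → u = v := fun u v => h4 u v (by simp) (by simp)
    refine ⟨σ, h1, hf, ?_, ?_⟩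
    · have e1 := card_support_le_sum_partnerPairs hτ h2
      have e2 := sum_adjInd_add_card_support_le hτ hm hΔ
      have : (2 * Δ + 1 : ℝ) * τ.support.card ≤ (2 * Δ + 1) * ∑ p ∈ partnerPairs σ, adjInd G p :=
        mul_le_mul_of_nonneg_left e1 (by positivity)
      have h0 : (0 : ℝ) ≤ τ.support.card := by positivity
      linarith
    · rw [outerPairs_eq_empty_of_even h1 hf hpar]
      simpa using htot
  have : Nonempty V := Fintype.card_pos_iff.1 (by omega)
  -- For odd order the unmatched vertex is chosen of minimum degree, so that few edges of `G` meet
  -- it. The matching is then a maximum one of `G` with `z` isolated.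
  obtain ⟨z, -, hz⟩ := exists_min_image (univ : Finset V) (fun v => G.degree v) univ_nonempty
  let G' : SimpleGraph V :=
    { Adj := fun x y => G.Adj x y ∧ x ≠ z ∧ y ≠ z
      symm := ⟨fun x y h => ⟨h.1.symm, h.2.2, h.2.1⟩⟩
      loopless := ⟨fun x h => h.1.ne rfl⟩ }
  have hG'le : G' ≤ G := fun x y h => h.1
  obtain ⟨τ, hτ, hm⟩ := IsMatchingPerm.exists_max G'
  have hτz : τ z = z := by
    by_contra h
    exact (hτ.2 z h).2.1 rfl
  obtain ⟨σ, h1, h2, h3, h4⟩ := exists_involution_extension hτ.1 {z} (by simpa using hτz)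
  have hσz : σ z = z := h3 z (by simp)
  have hτ' : IsMatchingPerm G τ := ⟨hτ.1, fun v hv => (hτ.2 v hv).1⟩
  have hsupp : σ.support = {z}ᶜ := by
    have hc : ((σ.supportᶜ).erase z).card ≤ 1 := card_le_one.2 fun u hu v hv => by
      simp only [mem_erase, mem_compl, Perm.mem_support, not_not] at hu hv
      exact h4 u v (by simpa using hu.1) (by simpa using hv.1) hu.2 hv.2
    have hzm : z ∈ σ.supportᶜ := by simp [hσz]
    rw [card_erase_of_mem hzm] at hc
    have hcc := card_compl_add_card σ.support
    have hpos := card_pos.2 ⟨z, hzm⟩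
    obtain ⟨a, ha⟩ := hpar
    obtain ⟨b, hb⟩ := IsMatchingPerm.even_card_support h1
    have : (σ.supportᶜ).card = 1 := by omega
    obtain ⟨w, hw⟩ := card_eq_one.1 this
    rw [hw, mem_singleton] at hzm
    rw [← compl_inj_iff, compl_compl, hw, hzm]
  have hf : ∀ u v, σ u = u → σ v = v → u = v := fun u v hu hv => by
    rw [← Perm.notMem_support, hsupp] at hu hv
    simp only [mem_compl, mem_singleton, not_not] at hu hv
    rw [hu, hv]
  have houter : ∑ p ∈ outerPairs σ, adjInd G p = G.degree z := by
    rw [sum_outerPairs, hsupp, compl_compl]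
    simp only [sum_singleton]
    rw [← sum_adjInd_right, ← sum_compl_add_sum {z}, sum_singleton, adjInd_self, add_zero]
    exact sum_congr rfl fun x _ => adjInd_swap G (z, x)
  have hmin : (Fintype.card V : ℝ) * G.degree z ≤ ∑ p, adjInd G p := by
    rw [sum_adjInd_eq_sum_degree]
    calc _ = ∑ x : V, (G.degree z : ℝ) := by rw [sum_const, card_univ, nsmul_eq_mul]
      _ ≤ _ := sum_le_sum fun x _ => by exact_mod_cast hz x (mem_univ x)
  have hsplit : ∑ p, adjInd G p = ∑ p, adjInd G' p + 2 * G.degree z := by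
    have hpt : ∀ x y, adjInd G (x, y) = adjInd G' (x, y) + (if x = z then adjInd G (x, y) else 0) +
        (if y = z then adjInd G (y, x) else 0) := fun x y => by
      by_cases hx : x = z
      · by_cases hy : y = z
        · simp [hx, hy, adjInd_self]
        · simp [adjInd, G', hx, hy]
      · by_cases hy : y = z
        · simp [adjInd, G', hx, hy, G.adj_comm]
        · simp [adjInd, G', hx, hy]
    have e : ∑ x, ∑ y, (if x = z then adjInd G (x, y) else 0) = G.degree z := by
      rw [← sum_adjInd_right, sum_comm]
      simp
    rw [Fintype.sum_prod_type, Fintype.sum_prod_type]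
    simp only [sum_congr rfl fun x _ => sum_congr rfl fun y _ => hpt x y, sum_add_distrib]
    rw [e, sum_comm (f := fun x y => if y = z then adjInd G (y, x) else 0), e]
    ring
  have hcov := sum_adjInd_add_card_support_le hτ hm (fun v => (SimpleGraph.degree_le_of_le hG'le).trans (hΔ v))
  have hG'0 : 0 ≤ ∑ p, adjInd G' p := sum_nonneg fun p _ => adjInd_nonneg G' p
  have hdeg' : ∀ v, v ≠ z → G.degree v ≤ G'.degree v + 1 := fun v hv => by
    rw [← G.card_neighborFinset_eq_degree, ← G'.card_neighborFinset_eq_degree]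
    refine le_trans (card_le_card (t := insert z (G'.neighborFinset v)) fun y hy => ?_)
      (card_insert_le _ _)
    rw [SimpleGraph.mem_neighborFinset] at hy
    by_cases hyz : y = z
    · simp [hyz]
    · exact mem_insert_of_mem ((G'.mem_neighborFinset v y).2 ⟨hy, hv, hyz⟩)
  -- Removing `z` costs `2 * deg z` ordered pairs; this inequality lets the factor `2Δ - 1` from the
  -- covering bound grow only to `2Δ + 1`. If two vertices other than `z` are unmatched, their
  -- degree sum gives `2 * deg z ≤ S + 2` with `S` the support size, which suffices unless `S = 0`;
  -- in that case `G'` has no edges and minimality forces `deg z = 0`.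
  have hgS : G.degree z ≤ τ.support.card := by
    have hgn := G.degree_lt_card_verts z
    by_cases hS : Fintype.card V ≤ τ.support.card + 1
    · omega
    obtain ⟨a, ha⟩ := hpar
    obtain ⟨b, hb⟩ := IsMatchingPerm.even_card_support hτ.1
    have hcc := card_compl_add_card τ.support
    have hzm : z ∈ τ.supportᶜ := by simp [hτz]
    have hcard := card_erase_of_mem hzm
    obtain ⟨u, hu, v, hv, huv⟩ := one_lt_card.1 (show 1 < ((τ.supportᶜ).erase z).card by omega)
    simp only [mem_erase, mem_compl, Perm.mem_support, not_not] at hu hv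
    have hd := hτ.degree_add_degree_le hm huv hu.2 hv.2
    have hu' := hdeg' u hu.1
    have hv' := hdeg' v hv.1
    have hzu := hz u (mem_univ u)
    have hzv := hz v (mem_univ v)
    by_cases hb0 : b = 0
    · have hS0 : τ.support.card = 0 := by omega
      rw [hS0] at hcov
      simp only [Nat.cast_zero, add_zero, mul_zero] at hcov
      have h3 : (3 : ℝ) ≤ Fintype.card V := by exact_mod_cast (by omega : 3 ≤ Fintype.card V)
      have hg0 : (0 : ℝ) ≤ G.degree z := by positivity
      have : (G.degree z : ℝ) ≤ 0 := by nlinarith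
      have : G.degree z ≤ 0 := by exact_mod_cast this
      omega
    · omega
  refine ⟨σ, h1, hf, ?_, by rw [houter]; exact hmin⟩
  have e1 := card_support_le_sum_partnerPairs hτ' h2
  have e3 : (2 * Δ + 1 : ℝ) * τ.support.card ≤ (2 * Δ + 1) * ∑ p ∈ partnerPairs σ, adjInd G p :=
    mul_le_mul_of_nonneg_left e1 (by positivity)
  have e4 : (G.degree z : ℝ) ≤ τ.support.card := by exact_mod_cast hgS
  linarith

end Hosts

/-! ### Inverting the Erdős–Gallai bounds and estimating the excess. -/

section Arithmetic

/-- The two bounds agree at `s = (2n - 3)/5`, where the number of edges is `(8n² - 14n + 3)/25`.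
Below that `s` the star bound is the larger one; above it the star bound already exceeds `2D`. -/
theorem star_bound_of_le {n s D : ℝ} (hn : 4 ≤ n) (hs0 : 0 ≤ s) (hs : 2 * s ≤ n)
    (hD : D ≤ (8 * n ^ 2 - 14 * n + 3) / 25)
    (h : 2 * D ≤ 2 * s * (2 * s + 1) ∨ 2 * D ≤ s * (2 * n - s - 1)) :
    2 * D ≤ s * (2 * n - s - 1) := by
  rcases h with h | h
  · rcases le_total s ((2 * n - 3) / 5) with h1 | h1
    · nlinarith [mul_nonneg hs0 (sub_nonneg.2 h1)]
    · nlinarith [mul_nonneg (sub_nonneg.2 h1)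
        (show 0 ≤ 2 * n - 1 - s - (2 * n - 3) / 5 by linarith)]
  · exact h

theorem clique_bound_of_lt {n s D : ℝ} (hn : 4 ≤ n) (hs0 : 0 ≤ s) (hs : 2 * s ≤ n)
    (hD : (8 * n ^ 2 - 14 * n + 3) / 25 < D)
    (h : 2 * D ≤ 2 * s * (2 * s + 1) ∨ 2 * D ≤ s * (2 * n - s - 1)) :
    2 * D ≤ 2 * s * (2 * s + 1) := by
  rcases h with h | h
  · exact h
  · rcases le_total s ((2 * n - 3) / 5) with h1 | h1
    · nlinarith [mul_nonneg (sub_nonneg.2 h1)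
        (show 0 ≤ 2 * n - 1 - s - (2 * n - 3) / 5 by linarith)]
    · nlinarith [mul_nonneg hs0 (sub_nonneg.2 h1)]

/-- At `s = (1-y)(n-1)` the right side is `(1-y²)n(n-1) - y(1-y)(n-1)`, at most the left side, and
it increases with `s`. It is applied with `y = √(1-d)`. -/
theorem le_of_star_bound {n s y : ℝ} (hn : 1 ≤ n) (hy0 : 0 ≤ y) (hy1 : y ≤ 1)
    (h : (1 - y ^ 2) * (n * (n - 1)) ≤ s * (2 * n - s - 1)) : (1 - y) * (n - 1) ≤ s := by
  by_contra hlt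
  have hu : 0 < (1 - y) * (n - 1) - s := by linarith
  have hz : 0 ≤ y * (n - 1) := mul_nonneg hy0 (by linarith)
  nlinarith [mul_pos hu hu, mul_nonneg hz hu.le, mul_nonneg hz (sub_nonneg.2 hy1)]

theorem le_of_clique_bound {n s x : ℝ} (hn : 0 ≤ n) (hs : 0 ≤ s) (hx0 : 0 ≤ x) (hx1 : x ≤ 1)
    (h : x ^ 2 * (n * (n - 1)) ≤ 2 * s * (2 * s + 1)) : x * n - 1 ≤ 2 * s := by
  by_contra hlt
  have hu : 0 < x * n - 1 - 2 * s := by linarith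
  nlinarith [mul_pos hu hu, mul_nonneg hs hu.le, mul_nonneg (mul_nonneg hx0 hn) (sub_nonneg.2 hx1)]

theorem excess_bound_even {n d t p R a a₁ a₂ Δ : ℝ} (hn : 4 ≤ n) (hd0 : 0 ≤ d) (ht : 0 ≤ t)
    (hp1 : p ≤ 1) (hp : d + t - 2 / (n - 3) ≤ p)
    (hR : R = (d * (n * (n - 1)) - n * p) / (n * (n - 2)))
    (h1 : 0 ≤ a₁) (h2 : 0 ≤ a₂) (hΔ : 0 ≤ Δ) (ha : a = a₁ + a₂) (haΔ : a ≤ (2 * Δ + 1) * a₁) :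
    (d + t / (2 * Δ + 1) - 3 / (n - 3)) * a ≤ a₁ * p + a₂ * R := by
  have hta : t / (2 * Δ + 1) * a ≤ t * a₁ := by
    rw [div_mul_eq_mul_div, div_le_iff₀ (by positivity)]
    nlinarith
  have he : 0 < 1 / (n - 3) := by apply one_div_pos.2; linarith
  have hRd : d - 3 / (n - 3) ≤ R := by
    have e1 : R = d + (d - p) / (n - 2) := by
      have : n - 2 ≠ 0 := by linarith
      have : n ≠ 0 := by linarith
      rw [hR]
      field_simp
      ring
    have e2 : -(1 / (n - 3)) ≤ (d - p) / (n - 2) := by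
      rw [neg_le_iff_add_nonneg, div_add_div _ _ (by linarith) (by linarith)]
      apply div_nonneg
      · nlinarith [mul_nonneg hd0 (show 0 ≤ n - 3 by linarith)]
      · nlinarith
    have : 3 / (n - 3) = 3 * (1 / (n - 3)) := by ring
    linarith
  have hpd : d + t - 3 / (n - 3) ≤ p := by
    have e3 : 3 / (n - 3) = 3 * (1 / (n - 3)) := by ring
    have e2 : 2 / (n - 3) = 2 * (1 / (n - 3)) := by ring
    linarith
  rw [ha] at *
  nlinarith [mul_le_mul_of_nonneg_left hRd h2, mul_le_mul_of_nonneg_left hpd h1]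

/-- The density `q` at the unmatched vertex of the host is uncontrolled and may be far below `d`.
The choice of the guest's unmatched vertex gives `a₃ ≤ a/(n-3)`, so the loss is of order `(d -
q)/(n-3)` per edge, and a small `q` raises the density `R` of the remaining pairs. -/
theorem excess_bound_odd {n d t p q R a a₁ a₂ a₃ Δ : ℝ} (hn : 5 ≤ n) (hd0 : 0 ≤ d) (hd1 : d ≤ 1)
    (ht : 0 ≤ t) (hp1 : p ≤ 1) (hq0 : 0 ≤ q) (hq1 : q ≤ 1) (hp : d + t - 1 / (n - 3) ≤ p)
    (hR : R = (d * (n * (n - 1)) - (n - 1) * p - 2 * ((n - 1) * q)) / ((n - 1) * (n - 3)))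
    (h1 : 0 ≤ a₁) (h2 : 0 ≤ a₂) (h3 : 0 ≤ a₃) (hΔ : 0 ≤ Δ) (ha : a = a₁ + a₂ + 2 * a₃)
    (haΔ : a ≤ (2 * Δ + 1) * a₁) (ha3 : n * a₃ ≤ a) :
    (d + t / (2 * Δ + 1) - 3 / (n - 3)) * a ≤ a₁ * p + a₂ * R + 2 * (a₃ * q) := by
  have hta : t / (2 * Δ + 1) * a ≤ t * a₁ := by
    rw [div_mul_eq_mul_div, div_le_iff₀ (by positivity)]
    nlinarith
  obtain ⟨e, he⟩ : ∃ e, e = 1 / (n - 3) := ⟨_, rfl⟩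
  have he0 : 0 < e := by rw [he]; apply one_div_pos.2; linarith
  have hRd : R = d + e * (3 * d - p - 2 * q) := by
    have : n - 3 ≠ 0 := by linarith
    have : n - 1 ≠ 0 := by linarith
    rw [hR, he]
    field_simp
    ring
  have hce : 3 / (n - 3) = 3 * e := by rw [he]; ring
  rw [← he] at hp
  rw [hce]
  have hae : a₃ ≤ e * a := by
    have hen : e * (n - 3) = 1 := by rw [he]; field_simp [show n - 3 ≠ 0 by linarith]
    have := mul_le_mul_of_nonneg_left ha3 he0.le
    nlinarith [mul_nonneg he0.le h3]
  suffices H : 0 ≤ a₁ * (p - d - t + 3 * e) + a₂ * (e * (3 + 3 * d - p - 2 * q)) +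
      2 * a₃ * (q - d + 3 * e) by
    rw [hRd]
    have : (d + t / (2 * Δ + 1) - 3 * e) * a ≤ (d - 3 * e) * (a₁ + a₂ + 2 * a₃) + t * a₁ := by
      rw [← ha]; linarith
    linarith
  have c1 : a₁ * (2 * e) ≤ a₁ * (p - d - t + 3 * e) := mul_le_mul_of_nonneg_left (by linarith) h1
  rcases le_total d q with hdq | hdq
  · have : 0 ≤ a₂ * (e * (3 + 3 * d - p - 2 * q)) :=
      mul_nonneg h2 (mul_nonneg he0.le (by linarith))
    have : 0 ≤ 2 * a₃ * (q - d + 3 * e) := mul_nonneg (by linarith) (by linarith)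
    have : 0 ≤ a₁ * (2 * e) := by positivity
    linarith
  -- The loss `2 * a₃ * (d - q)` is at most `2 * e * (d - q) * a`, and the slack in each of the
  -- three classes pays for its own share of `a`.
  · have hw : 0 ≤ d - q := by linarith
    have hw1 : d - q ≤ 1 := by linarith
    have c1' : a₁ * (2 * e * (d - q)) ≤ a₁ * (2 * e) :=
      mul_le_mul_of_nonneg_left (by nlinarith) h1
    have c2 : a₂ * (2 * e * (d - q)) ≤ a₂ * (e * (3 + 3 * d - p - 2 * q)) :=
      mul_le_mul_of_nonneg_left (by nlinarith) h2
    have c3 : a₃ * (4 * e * (d - q)) ≤ a₃ * (6 * e) :=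
      mul_le_mul_of_nonneg_left (by nlinarith) h3
    have c4 := mul_le_mul_of_nonneg_right hae hw
    rw [ha] at c4
    linarith

end Arithmetic

/-! ### The graph of `+1` edges and aligned copies of `G`. -/

section PlusGraph

open Equiv Finset

variable {V : Type*}

/-- The graph formed by the edges with label `1`. -/
def plusGraph (c : (⊤ : SimpleGraph V).edgeSet → ℤ) : SimpleGraph V :=
  SimpleGraph.fromEdgeSet {e | ∃ h : e ∈ (⊤ : SimpleGraph V).edgeSet, c ⟨e, h⟩ = 1}

theorem plusEdges_eq (c : (⊤ : SimpleGraph V).edgeSet → ℤ) (H : SimpleGraph V) :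
    plusEdges c H = (H ⊓ plusGraph c).edgeSet.ncard := by
  rw [plusEdges, ← Set.ncard_image_of_injective _ Subtype.val_injective]
  congr 1
  ext e
  simp only [Set.mem_image, Set.mem_ofPred_eq, Subtype.exists, exists_and_right, exists_eq_right,
    plusGraph, SimpleGraph.edgeSet_inf, SimpleGraph.edgeSet_fromEdgeSet, Set.mem_inter_iff,
    Set.mem_sdiff]
  constructor
  · rintro ⟨h, hH, hc⟩
    exact ⟨hH, ⟨h, hc⟩, SimpleGraph.not_isDiag_of_mem_edgeSet _ h⟩
  · rintro ⟨hH, ⟨h, hc⟩, _⟩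
    exact ⟨h, hH, hc⟩

variable [Fintype V] [DecidableEq V]

omit [DecidableEq V] in
theorem two_mul_plusEdges_permCopy (c : (⊤ : SimpleGraph V).edgeSet → ℤ) (G : SimpleGraph V)
    (π : Perm V) : 2 * (plusEdges c (permCopy G π) : ℝ) =
      ∑ p : V × V, adjInd G p * adjInd (plusGraph c) (π p.1, π p.2) := by
  rw [plusEdges_eq, ← sum_adjInd]
  refine (Fintype.sum_equiv (π.prodCongr π) _ _ fun p => ?_).symm
  have h : (permCopy G π).Adj (π p.1) (π p.2) ↔ G.Adj p.1 p.2 := by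
    exact SimpleGraph.map_adj_apply (f := π.toEmbedding)
  by_cases h1 : G.Adj p.1 p.2 <;> by_cases h2 : (plusGraph c).Adj (π p.1) (π p.2) <;>
    simp [adjInd, h, h1, h2]

omit [DecidableEq V] in
theorem two_mul_plusEdges_top (c : (⊤ : SimpleGraph V).edgeSet → ℤ) :
    2 * (plusEdges c ⊤ : ℝ) = ∑ p, adjInd (plusGraph c) p := by
  rw [plusEdges_eq, top_inf_eq, sum_adjInd]

theorem sum_partnerPairs_conj {σ τ π : Perm V} (h : ∀ x, π (σ x) = τ (π x)) (f : V × V → ℝ) :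
    ∑ p ∈ partnerPairs τ, f (π.symm p.1, π.symm p.2) = ∑ p ∈ partnerPairs σ, f p := by
  have hs : ∀ x, π x ∈ τ.support ↔ x ∈ σ.support := fun x => by
    rw [Perm.mem_support, Perm.mem_support, ← h, π.injective.ne_iff]
  have hs' : ∀ x, π.symm x ∈ σ.support ↔ x ∈ τ.support := fun x => by
    rw [← hs, apply_symm_apply]
  refine sum_nbij' (fun p => (π.symm p.1, π.symm p.2)) (fun p => (π p.1, π p.2)) ?_ ?_ (by simp)
    (by simp) (by simp)
  · intro p hp
    simp only [partnerPairs, mem_filter, mem_univ, true_and, hs'] at hp ⊢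
    exact ⟨hp.1, by rw [symm_apply_eq, h, apply_symm_apply, hp.2]⟩
  · intro p hp
    simp only [partnerPairs, mem_filter, mem_univ, true_and, hs] at hp ⊢
    exact ⟨hp.1, by rw [← h, hp.2]⟩

theorem sum_outerPairs_conj {σ τ π : Perm V} (h : ∀ x, π (σ x) = τ (π x)) (f : V × V → ℝ) :
    ∑ p ∈ outerPairs τ, f (π.symm p.1, π.symm p.2) = ∑ p ∈ outerPairs σ, f p := by
  have hs : ∀ x, π x ∈ τ.support ↔ x ∈ σ.support := fun x => by
    rw [Perm.mem_support, Perm.mem_support, ← h, π.injective.ne_iff]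
  have hs' : ∀ x, π.symm x ∈ σ.support ↔ x ∈ τ.support := fun x => by
    rw [← hs, apply_symm_apply]
  refine sum_nbij' (fun p => (π.symm p.1, π.symm p.2)) (fun p => (π p.1, π p.2)) ?_ ?_ (by simp)
    (by simp) (by simp)
  · intro p hp
    simpa only [outerPairs, mem_filter, mem_univ, true_and, hs'] using hp
  · intro p hp
    simpa only [outerPairs, mem_filter, mem_univ, true_and, hs] using hp

omit [Fintype V] [DecidableEq V] in
theorem sum_adjInd_le_card (A : Finset (V × V)) (P : SimpleGraph V) :
    ∑ p ∈ A, adjInd P p ≤ A.card := by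
  calc _ ≤ ∑ p ∈ A, (1 : ℝ) := sum_le_sum fun p _ => adjInd_le_one P p
    _ = _ := by simp

/-- A copy of `G` with many edges in `P`, given almost perfect matchings of both. -/
theorem exists_copy_sum_ge (G P : SimpleGraph V) {σ τ : Perm V} (hσ : ∀ v, σ (σ v) = v)
    (hσf : ∀ u v, σ u = u → σ v = v → u = v) (hτ : ∀ v, τ (τ v) = v)
    (hτf : ∀ u v, τ u = u → τ v = v → u = v) : ∃ π : Perm V,
      (∑ p ∈ partnerPairs σ, adjInd G p) * (∑ p ∈ partnerPairs τ, adjInd P p) /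
          (partnerPairs τ).card +
        (∑ p, adjInd G p - ∑ p ∈ partnerPairs σ, adjInd G p - 2 * ∑ p ∈ outerPairs σ, adjInd G p) *
          (∑ p, adjInd P p - ∑ p ∈ partnerPairs τ, adjInd P p -
            2 * ∑ p ∈ outerPairs τ, adjInd P p) / (nonpartnerPairs τ).card +
        2 * ((∑ p ∈ outerPairs σ, adjInd G p) * (∑ p ∈ outerPairs τ, adjInd P p) /
          (outerPairs τ).card) ≤
      ∑ p : V × V, adjInd G p * adjInd P (π p.1, π p.2) := by
  obtain ⟨ρ, hρ⟩ := exists_conj_of_near_perfect hσ hσf hτ hτf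
  obtain ⟨γ, hγ⟩ := exists_perm_sum_ge hτ hτf (fun p => adjInd G (ρ.symm p.1, ρ.symm p.2))
    (adjInd P) (fun x => adjInd_self G _) (fun p => adjInd_swap G (ρ.symm p.1, ρ.symm p.2))
    (adjInd_swap P)
  have htot : ∑ p : V × V, adjInd G (ρ.symm p.1, ρ.symm p.2) = ∑ p, adjInd G p :=
    Fintype.sum_equiv (ρ.symm.prodCongr ρ.symm) _ _ fun p => rfl
  have hG := sum_eq_sum_pairs hτf (fun p => adjInd G (ρ.symm p.1, ρ.symm p.2))
    (fun x => adjInd_self G _)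
  have hP := sum_eq_sum_pairs hτf (adjInd P) (adjInd_self P)
  have hsw : ∑ p ∈ outerPairs τ, adjInd G (ρ.symm p.swap.1, ρ.symm p.swap.2) =
      ∑ p ∈ outerPairs τ, adjInd G (ρ.symm p.1, ρ.symm p.2) :=
    sum_congr rfl fun p _ => adjInd_swap G (ρ.symm p.1, ρ.symm p.2)
  simp only [adjInd_swap] at hP
  rw [hsw, htot, sum_partnerPairs_conj hρ, sum_outerPairs_conj hρ] at hG
  rw [sum_partnerPairs_conj hρ, sum_outerPairs_conj hρ] at hγ
  -- First `ρ` aligns the matching of `G` with that of `P`, then `γ` from the averaging preserves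
  -- the alignment.
  refine ⟨γ * ρ, le_trans (le_of_eq ?_) (hγ.trans (le_of_eq ?_))⟩
  · rw [show ∑ p, adjInd G p - ∑ p ∈ partnerPairs σ, adjInd G p -
      2 * ∑ p ∈ outerPairs σ, adjInd G p =
      ∑ p ∈ nonpartnerPairs τ, adjInd G (ρ.symm p.1, ρ.symm p.2) by linarith,
      show ∑ p, adjInd P p - ∑ p ∈ partnerPairs τ, adjInd P p -
      2 * ∑ p ∈ outerPairs τ, adjInd P p = ∑ p ∈ nonpartnerPairs τ, adjInd P p by linarith]
  · refine (Fintype.sum_equiv (ρ.prodCongr ρ) _ _ fun p => ?_).symm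
    simp

end PlusGraph

/-! ### The gain over the average, and the theorem. -/

section Main

open Equiv Finset

variable {V : Type*} [Fintype V] [DecidableEq V]

/-- A copy of `G` with many edges in `P`, when the maximum matchings of `P` are known to be large
in the sense of the Erdős–Gallai bound. -/
theorem exists_copy_excess (G P : SimpleGraph V) [DecidableRel G.Adj] {n Δ : ℕ} {d : ℝ}
    (hV : Fintype.card V = n) (hn : 4 ≤ n) (hΔ : ∀ v, G.degree v ≤ Δ) (hd0 : 0 ≤ d) (hd1 : d ≤ 1)
    (hP : ∑ p, adjInd P p = d * ((n : ℝ) * (n - 1))) {t : ℝ} (ht : 0 ≤ t)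
    (hlarge : ∀ s : ℕ, 2 * s ≤ n →
      (d * ((n : ℝ) * (n - 1)) ≤ 2 * s * (2 * s + 1) ∨
        d * ((n : ℝ) * (n - 1)) ≤ s * (2 * (n : ℝ) - s - 1)) →
      (d + t) * n - 1 ≤ 2 * s ∨ (d + t) * (n - 1) ≤ 2 * s)
    (hdt : d + t ≤ 2) :
    ∃ π : Perm V, (d + t / (2 * (Δ : ℝ) + 1) - 3 / ((n : ℝ) - 3)) * ∑ p, adjInd G p ≤
      ∑ p : V × V, adjInd G p * adjInd P (π p.1, π p.2) := by
  have : Nonempty V := Fintype.card_pos_iff.1 (by omega)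
  have hnR : (4 : ℝ) ≤ n := by exact_mod_cast hn
  obtain ⟨τ, s, hτ, hτf, hs, hsP, hEG⟩ := exists_near_perfect_of_host P
  obtain ⟨σ, hσ, hσf, hGΔ, hGo⟩ := exists_near_perfect_of_guest G hΔ (by omega)
  obtain ⟨π, hπ⟩ := exists_copy_sum_ge G P hσ hσf hτ hτf
  refine ⟨π, le_trans ?_ hπ⟩
  rw [hP, hV] at hEG
  rw [hV] at hs hGo
  have hsn := hlarge s hs hEG
  have hcσ := card_support_add_mod_two hσ hσf
  have hcard := card_support_add_mod_two hτ hτf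
  have hp1 := sum_adjInd_le_card (partnerPairs τ) P
  have hq1 := sum_adjInd_le_card (outerPairs τ) P
  have hq0 : 0 ≤ ∑ p ∈ outerPairs τ, adjInd P p := sum_nonneg fun p _ => adjInd_nonneg P p
  have ha1 : 0 ≤ ∑ p ∈ partnerPairs σ, adjInd G p := sum_nonneg fun p _ => adjInd_nonneg G p
  have ha3 : 0 ≤ ∑ p ∈ outerPairs σ, adjInd G p := sum_nonneg fun p _ => adjInd_nonneg G p
  have ha2 : 0 ≤ ∑ p, adjInd G p - ∑ p ∈ partnerPairs σ, adjInd G p -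
      2 * ∑ p ∈ outerPairs σ, adjInd G p := by
    have h := sum_eq_sum_pairs hσf (adjInd G) (adjInd_self G)
    simp only [adjInd_swap] at h
    have h2 : 0 ≤ ∑ p ∈ nonpartnerPairs σ, adjInd G p := sum_nonneg fun p _ => adjInd_nonneg G p
    linarith
  rw [hV] at hcard
  have hSge : 4 ≤ τ.support.card := by
    obtain ⟨k, hk⟩ := IsMatchingPerm.even_card_support hτ
    omega
  rw [card_nonpartnerPairs, card_outerPairs, hP, hV]
  rw [card_partnerPairs] at hp1 ⊢
  rw [card_outerPairs, hV] at hq1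
  push_cast [Nat.cast_sub (show 2 ≤ τ.support.card by omega),
    Nat.cast_sub (show τ.support.card ≤ n by omega)] at hq1 ⊢
  set a := ∑ p, adjInd G p
  set a₁ := ∑ p ∈ partnerPairs σ, adjInd G p
  set a₃ := ∑ p ∈ outerPairs σ, adjInd G p
  set b₁ := ∑ p ∈ partnerPairs τ, adjInd P p
  set b₃ := ∑ p ∈ outerPairs τ, adjInd P p
  have hdt0 : 0 ≤ d + t := by linarith
  have hn3 : (0 : ℝ) < n - 3 := by linarith
  rcases Nat.even_or_odd n with hpar | hpar
  · have hS : τ.support.card = n := by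
      rw [Nat.even_iff] at hpar
      omega
    have e1 : a₃ = 0 := by
      simp [a₃, outerPairs_eq_empty_of_even hσ hσf (hV ▸ hpar)]
    have e2 : b₃ = 0 := by
      simp [b₃, outerPairs_eq_empty_of_even hτ hτf (hV ▸ hpar)]
    rw [hS] at hp1 ⊢
    rw [e1, e2]
    rw [e1] at ha2
    have hn0 : (0 : ℝ) < n := by linarith
    have hb : b₁ = n * (b₁ / n) := by field_simp
    have := excess_bound_even (n := n) (d := d) (t := t) (p := b₁ / n) (a := a) (a₁ := a₁)
      (a₂ := a - a₁ - 2 * 0) (Δ := Δ) hnR hd0 ht ((div_le_one hn0).2 hp1) (by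
        have h2 : 2 / (n : ℝ) ≤ 2 / (n - 3) :=
          div_le_div_of_nonneg_left (by norm_num) hn3 (by linarith)
        -- The alternative `(d + t)(n - 1) ≤ 2s` loses `d + t` against `(d + t)n`; this is where `d
        -- + t ≤ 2` enters.
        have h3 : d + t - 2 / n ≤ b₁ / n := by
          rw [le_div_iff₀ hn0, sub_mul, div_mul_cancel₀ _ hn0.ne']
          rcases hsn with h | h <;> linarith
        linarith) rfl ha1 ha2 (by positivity) (by ring) hGΔ
    refine this.trans (le_of_eq ?_)
    rw [← hb]
    ring
  · have hS : τ.support.card = n - 1 := by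
      rw [Nat.odd_iff] at hpar
      omega
    have hn5 : 5 ≤ n := by
      obtain ⟨k, hk⟩ := hpar
      omega
    have hSR : (τ.support.card : ℝ) = n - 1 := by
      rw [hS, Nat.cast_sub (by omega), Nat.cast_one]
    rw [hSR] at hp1 hq1 ⊢
    have hn1 : (0 : ℝ) < n - 1 := by linarith
    have hb : (n - 1) * (b₁ / (n - 1)) = b₁ := by field_simp
    have hb3 : (n - 1) * (b₃ / (n - 1)) = b₃ := by field_simp
    have := excess_bound_odd (n := n) (d := d) (t := t) (p := b₁ / (n - 1)) (q := b₃ / (n - 1))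
      (a := a) (a₁ := a₁) (a₂ := a - a₁ - 2 * a₃) (a₃ := a₃) (Δ := Δ) (by exact_mod_cast hn5)
      hd0 hd1 ht ((div_le_one hn1).2 hp1) (div_nonneg hq0 hn1.le)
      ((div_le_one hn1).2 (by linarith)) (by
        have h2 : 1 / ((n : ℝ) - 1) ≤ 1 / (n - 3) :=
          div_le_div_of_nonneg_left (by norm_num) hn3 (by linarith)
        have h3 : d + t - 1 / (n - 1) ≤ b₁ / (n - 1) := by
          rw [le_div_iff₀ hn1, sub_mul, div_mul_cancel₀ _ hn1.ne']
          rcases hsn with h | h <;> linarith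
        linarith) rfl ha1 ha2 ha3 (by positivity) (by ring) hGΔ hGo
    refine this.trans (le_of_eq ?_)
    rw [hb, hb3]
    ring

end Main

theorem theorem1 {V : Type*} [Fintype V] (n Δ : ℕ) (d : ℝ)
    (hV : Fintype.card V = n) (hn : 4 ≤ n)
    (c : (⊤ : SimpleGraph V).edgeSet → ℤ) (hc : ∀ e, c e = 1 ∨ c e = -1)
    (hd : (plusEdges c ⊤ : ℝ) = d * (n.choose 2 : ℝ))
    (G : SimpleGraph V) [DecidableRel G.Adj] (hG : G.maxDegree ≤ Δ) :
    ∃ π : Equiv.Perm V,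
      (d * (n.choose 2 : ℝ) ≤ (8 * (n : ℝ) ^ 2 - 14 * (n : ℝ) + 3) / 25 →
        (plusEdges c (permCopy G π) : ℝ) ≥
          (d + (2 - d - 2 * Real.sqrt (1 - d)) / (2 * (Δ : ℝ) + 1) - 3 / ((n : ℝ) - 3)) *
            (G.edgeSet.ncard : ℝ)) ∧
      (¬ d * (n.choose 2 : ℝ) ≤ (8 * (n : ℝ) ^ 2 - 14 * (n : ℝ) + 3) / 25 →
        (plusEdges c (permCopy G π) : ℝ) ≥
          (d + (Real.sqrt d - d) / (2 * (Δ : ℝ) + 1) - 3 / ((n : ℝ) - 3)) *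
            (G.edgeSet.ncard : ℝ)) := by
  classical
  have hnR : (4 : ℝ) ≤ n := by exact_mod_cast hn
  have hΔ : ∀ v, G.degree v ≤ Δ := fun v => (G.degree_le_maxDegree v).trans hG
  have hchoose : (n.choose 2 : ℝ) = n * (n - 1) / 2 := Nat.cast_choose_two ℝ n
  have hpos : (0 : ℝ) < n * (n - 1) := mul_pos (by linarith) (by linarith)
  have hP : ∑ p, adjInd (plusGraph c) p = d * ((n : ℝ) * (n - 1)) := by
    rw [← two_mul_plusEdges_top, hd, hchoose]
    ring
  have hd0 : 0 ≤ d := by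
    have h0 : 0 ≤ ∑ p, adjInd (plusGraph c) p := Finset.sum_nonneg fun p _ => adjInd_nonneg _ p
    rw [hP] at h0
    exact nonneg_of_mul_nonneg_left h0 hpos
  have hd1 : d ≤ 1 := by
    have h1 : ∑ p, adjInd (plusGraph c) p ≤ (n : ℝ) * (n - 1) := by
      rw [sum_adjInd_eq_sum_degree]
      calc _ ≤ ∑ x : V, ((n : ℝ) - 1) := Finset.sum_le_sum fun x _ => by
            have := (plusGraph c).degree_lt_card_verts x
            rw [hV] at this
            rw [le_sub_iff_add_le]
            exact_mod_cast this
        _ = _ := by rw [Finset.sum_const, Finset.card_univ, nsmul_eq_mul, hV]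
    rw [hP] at h1
    nlinarith
  have hD2 : d * ((n : ℝ) * (n - 1)) = 2 * (d * n.choose 2) := by
    rw [hchoose]
    ring
  by_cases hD : d * (n.choose 2 : ℝ) ≤ (8 * (n : ℝ) ^ 2 - 14 * (n : ℝ) + 3) / 25
  · have hy0 : 0 ≤ √(1 - d) := Real.sqrt_nonneg _
    have hy1 : √(1 - d) ≤ 1 := Real.sqrt_le_one.2 (by linarith)
    have hy2 : √(1 - d) ^ 2 = 1 - d := Real.sq_sqrt (by linarith)
    -- Here `t = (1 - √(1-d))²`, and `d + t = 2(1 - √(1-d))` is the matching density forced by the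
    -- star bound.
    obtain ⟨π, hπ⟩ := exists_copy_excess G (plusGraph c) hV hn hΔ hd0 hd1 hP
      (t := 2 - d - 2 * √(1 - d)) (by nlinarith [sq_nonneg (1 - √(1 - d))])
      (fun s hs h => Or.inr (by
        rw [hD2] at h
        have h1 := star_bound_of_le hnR (Nat.cast_nonneg s) (by exact_mod_cast hs) hD h
        have h2 := le_of_star_bound (n := n) (s := s) (by linarith) hy0 hy1 (by
          rw [hy2, sub_sub_cancel, hD2]
          exact h1)
        linarith)) (by linarith)
    refine ⟨π, fun _ => ?_, fun h => absurd hD h⟩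
    rw [← two_mul_plusEdges_permCopy, sum_adjInd] at hπ
    linarith
  · have hx0 : 0 ≤ √d := Real.sqrt_nonneg _
    have hx1 : √d ≤ 1 := Real.sqrt_le_one.2 hd1
    have hx2 : √d ^ 2 = d := Real.sq_sqrt hd0
    -- Here `d + t = √d`, the matching density forced by the clique bound.
    obtain ⟨π, hπ⟩ := exists_copy_excess G (plusGraph c) hV hn hΔ hd0 hd1 hP
      (t := √d - d) (by nlinarith)
      (fun s hs h => Or.inl (by
        rw [hD2] at h
        have h1 := clique_bound_of_lt hnR (Nat.cast_nonneg s) (by exact_mod_cast hs) (not_le.1 hD) h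
        have h2 := le_of_clique_bound (n := n) (s := s) (by linarith) (Nat.cast_nonneg s) hx0 hx1 (by
          rw [hx2, hD2]
          exact h1)
        linarith)) (by linarith)
    refine ⟨π, fun h => absurd h hD, fun _ => ?_⟩
    rw [← two_mul_plusEdges_permCopy, sum_adjInd] at hπ
    linarith
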